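/- **Conventions.** For a topological space $X$, $RC(X)$ denotes the Boolean algebra of all regular closed subsets of $X$ (sets $F$ with $F=\mathrm{cl}(\mathrm{int}\,F)$), with $F+G=F\cup G$, $F\cdot G=\mathrm{cl}(\mathrm{int}(F\cap G))$, $F^*=\mathrm{cl}(X\setminus F)$, $0=\emptyset$, $1=X$. A *contact relation* on a Boolean algebra $B$ is a binary relation $C$ on $B$ such that: $aCb$ implies $a\neq 0$ and $b\neq 0$; $aC(b+c)$ iff $aCb$ or $aCc$; $(a+b)Cc$ iff $aCc$ or $bCc$; $a\ne 0$ implies $aCa$; $aCb$ implies $bCa$. It is *connected* if $a\neq 0,1$ implies $aCa^*$ or $a^*Ca$. Let $\mathrm{CRel}(B)$ (resp. $\mathrm{CCRel}(B)$) be the set of all (resp. all connected) contact relations on $B$, and put $C_1\le C_2$ iff $C_1\supseteq C_2$. A *clan* of $(B,C)$ is a non-empty set $\Gamma\subseteq B$ with $0\notin\Gamma$; $a\in\Gamma$, $a\le b$ imply $b\in\Gamma$; $a+b\in\Gamma$ implies $a\in\Gamma$ or $b\in\Gamma$; and $aCb$ for all $a,b\in\Gamma$. A $T_0$-space $X$ is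 *C-semiregular* if it is semiregular (every closed set is an intersection of regular closed sets) and for every clan $\Gamma$ of $(RC(X),C_X)$, where $F\,C_X\,G$ iff $F\cap G\neq\emptyset$, there is $x\in X$ with $\Gamma=\{F\in RC(X): x\in F\}$. An *extension* of a space $Y$ is a pair $(X,f)$ of a space $X$ and a dense embedding $f:Y\to X$; it is C-semiregular (connected) if $X$ is. (The empty space counts as connected.) Extensions $(X_1,f_1)$, $(X_2,f_2)$ of $Y$ are *equivalent* if there is a homeomorphism $\varphi:X_1\to X_2$ with $\varphi\circ f_1=f_2$. Write $[(X_1,f_1)]\le[(X_2,f_2)]$ (projective order) if there is a continuous $f:X_2\to X_1$ with $f\circ f_2=f_1$, and $[(X_1,f_1)]\le_{in}[(X_2,f_2)]$ (injective order) if there is a continuous $f:X_1\to X_2$ with $f\circ f_1=f_2$ which is a homeomorphism of $X_1$ onto the subspace $f(X_1)$ of $X_2$; these relations on equivalence classes are well defined. Let $\mathrm{CSR}(Y)$ (resp. $\mathrm{CCSR}(Y)$) be the class of all C-semiregular (resp. connected C-semiregular) extensions of $Y$ up to equivalence. **Theorem.** Let $Y$ be an extremally disconnected compact Hausdorff space and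 $B=RC(Y)$. Then the ordered sets $(\mathrm{CRel}(B),\le)$ and $(\mathrm{CSR}(Y),\le)$ are isomorphic, and the ordered sets $(\mathrm{CRel}(B),\subseteq)$ and $(\mathrm{CSR}(Y),\le_{in})$ are isomorphic. Also, the ordered sets $(\mathrm{CCRel}(B),\le)$ and $(\mathrm{CCSR}(Y),\le)$ are isomorphic, and the ordered sets $(\mathrm{CCRel}(B),\subseteq)$ and $(\mathrm{CCSR}(Y),\le_{in})$ are isomorphic. -/

import Mathlib

universe u

namespace ContactExt

section Algebra

variable {B : Type u} [BooleanAlgebra B]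

/-- `C` is a precontact relation on the Boolean algebra `B`. -/
structure IsPrecontact (C : B → B → Prop) : Prop where
  ne_bot : ∀ a b, C a b → a ≠ ⊥ ∧ b ≠ ⊥
  sup_right : ∀ a b c, C a (b ⊔ c) ↔ C a b ∨ C a c
  sup_left : ∀ a b c, C (a ⊔ b) c ↔ C a c ∨ C b c

/-- `C` is a contact relation on `B`: a reflexive (on nonzero elements) and symmetric precontact
relation. -/
structure IsContact (C : B → B → Prop) : Prop extends IsPrecontact C where
  refl : ∀ a, a ≠ ⊥ → C a a
  symm : ∀ a b, C a b → C b a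

/-- The connectedness axiom for a relation `C` on `B`. -/
def IsConnectedRel (C : B → B → Prop) : Prop :=
  ∀ a, a ≠ ⊥ → a ≠ ⊤ → C a aᶜ ∨ C aᶜ a

/-- The contact relation `C^#` generated by a precontact relation `C`; it is `C` itself when `C`
is a contact relation. -/
def sharp (C : B → B → Prop) (a b : B) : Prop :=
  C a b ∨ C b a ∨ a ⊓ b ≠ ⊥

/-- `Γ` is a clan of the (pre)contact algebra `(B, C)`. -/
structure IsClan (C : B → B → Prop) (Γ : Set B) : Prop where
  nonempty : Γ.Nonempty
  bot_notMem : ⊥ ∉ Γ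
  mem_of_le : ∀ a b, a ∈ Γ → a ≤ b → b ∈ Γ
  mem_or_mem : ∀ a b, a ⊔ b ∈ Γ → a ∈ Γ ∨ b ∈ Γ
  sharp_of_mem : ∀ a b, a ∈ Γ → b ∈ Γ → sharp C a b

variable (B) in
/-- The set of all contact relations on `B`. -/
abbrev CRel : Type u := {C : B → B → Prop // IsContact C}

variable (B) in
/-- The set of all connected contact relations on `B`. -/
abbrev CCRel : Type u := {C : B → B → Prop // IsContact C ∧ IsConnectedRel C}

end Algebra

/-- Inclusion of relations, on a set of relations cut out by `P`. -/
def relSubset {B : Type u} {P : (B → B → Prop) → Prop} (C₁ C₂ : Subtype P) : Prop :=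
  ∀ a b, C₁.1 a b → C₂.1 a b

/-- The order `C₁ ≤ C₂ ↔ C₁ ⊇ C₂`, on a set of relations cut out by `P`. -/
def relLE {B : Type u} {P : (B → B → Prop) → Prop} (C₁ C₂ : Subtype P) : Prop :=
  relSubset C₂ C₁

/-- `RC(X)`: the regular closed subsets of the space `X`. -/
def RC (X : Type u) [TopologicalSpace X] : Type u := {F : Set X // closure (interior F) = F}

namespace RC

variable {X : Type u} [TopologicalSpace X]

theorem isClosed (F : RC X) : IsClosed F.1 := by
  rw [← F.2]; exact isClosed_closure

/-- The closure of an open set is regular closed. -/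
theorem regular_of_open {U : Set X} (hU : IsOpen U) :
    closure (interior (closure U)) = closure U := by
  apply subset_antisymm
  · exact closure_minimal interior_subset isClosed_closure
  · exact closure_mono (hU.subset_interior_iff.2 subset_closure)

theorem union_regular (F G : RC X) : closure (interior (F.1 ∪ G.1)) = F.1 ∪ G.1 := by
  apply subset_antisymm
  · exact closure_minimal interior_subset (F.isClosed.union G.isClosed)
  · refine Set.union_subset ?_ ?_
    · conv_lhs => rw [← F.2]
      exact closure_mono (interior_mono Set.subset_union_left)
    · conv_lhs => rw [← G.2]
      exact closure_mono (interior_mono Set.subset_union_right)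

theorem subset_meet {F : RC X} {S : Set X} (h : F.1 ⊆ S) : F.1 ⊆ closure (interior S) := by
  conv_lhs => rw [← F.2]
  exact closure_mono (interior_mono h)

theorem meet_subset {S : Set X} (h : IsClosed S) : closure (interior S) ⊆ S :=
  closure_minimal interior_subset h

/-- The Boolean algebra of regular closed sets, ordered by inclusion: `F + G = F ∪ G`,
`F . G = cl (int (F ∩ G))`, `F* = cl (X \ F)`, `0 = ∅`, `1 = X`. -/
instance : BooleanAlgebra (RC X) :=
  let L : Lattice (RC X) :=
    { le := fun F G => F.1 ⊆ G.1
      le_refl := fun _ => subset_rfl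
      le_trans := fun _ _ _ h k => h.trans k
      le_antisymm := fun _ _ h k => Subtype.ext (subset_antisymm h k)
      sup := fun F G => ⟨F.1 ∪ G.1, union_regular F G⟩
      le_sup_left := fun _ _ => Set.subset_union_left
      le_sup_right := fun _ _ => Set.subset_union_right
      sup_le := fun _ _ _ h k => Set.union_subset h k
      inf := fun F G => ⟨closure (interior (F.1 ∩ G.1)), regular_of_open isOpen_interior⟩
      inf_le_left := fun F G =>
        (meet_subset (F.isClosed.inter G.isClosed)).trans Set.inter_subset_left
      inf_le_right := fun F G =>
        (meet_subset (F.isClosed.inter G.isClosed)).trans Set.inter_subset_right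
      le_inf := fun _ _ _ h k => subset_meet (Set.subset_inter h k) }
  { DistribLattice.ofInfSupLe (α := RC X) (by
      intro F G H
      change closure (interior (F.1 ∩ (G.1 ∪ H.1))) ⊆
        closure (interior (F.1 ∩ G.1)) ∪ closure (interior (F.1 ∩ H.1))
      refine closure_minimal ?_ (isClosed_closure.union isClosed_closure)
      intro x hx
      have key : ∀ K : RC X, x ∈ K.1 → x ∈ closure (interior (F.1 ∩ K.1)) := by
        intro K hK
        rw [← K.2] at hK
        refine closure_mono ?_ (isOpen_interior.inter_closure ⟨hx, hK⟩)
        rw [← interior_inter]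
        exact interior_mono (Set.inter_subset_inter_left _ Set.inter_subset_left)
      exact (interior_subset hx).2.imp (key G) (key H)) with
    top := ⟨Set.univ, by simp⟩
    bot := ⟨∅, by simp⟩
    compl := fun F => ⟨closure (F.1ᶜ), regular_of_open (isClosed F).isOpen_compl⟩
    le_top := fun _ => Set.subset_univ _
    bot_le := fun _ => Set.empty_subset _
    inf_compl_le_bot := by
      intro F
      change closure (interior (F.1 ∩ closure (F.1ᶜ))) ⊆ ∅
      have h : interior (F.1 ∩ closure (F.1ᶜ)) = ∅ := by
        rw [interior_inter, closure_compl]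
        exact Set.eq_empty_of_forall_notMem fun x hx => (interior_subset hx.2) hx.1
      rw [h, closure_empty]
    top_le_sup_compl := by
      intro F x _
      change x ∈ F.1 ∪ closure (F.1ᶜ)
      by_cases hx : x ∈ F.1
      · exact Or.inl hx
      · exact Or.inr (subset_closure hx) }

/-- The standard contact relation `C_X` on `RC(X)`. -/
def contact (X : Type u) [TopologicalSpace X] (F G : RC X) : Prop := (F.1 ∩ G.1).Nonempty

/-- `σ_x`, the set of all regular closed sets containing the point `x`. -/
def sigma (x : X) : Set (RC X) := {F | x ∈ F.1}

end RC

/-- `X` is semiregular: the regular closed sets form a closed base, that is, every closed set is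
an intersection of regular closed sets. -/
def IsSemiregular (X : Type u) [TopologicalSpace X] : Prop :=
  ∀ K : Set X, IsClosed K → ∃ R : Set (RC X), K = ⋂ F ∈ R, F.1

/-- C-semiregular spaces. -/
structure IsCSemiregular (X : Type u) [TopologicalSpace X] : Prop where
  t0 : T0Space X
  semiregular : IsSemiregular X
  exists_point : ∀ Γ : Set (RC X), IsClan (RC.contact X) Γ → ∃ x : X, Γ = RC.sigma x

/-- An extension of the space `Y`: a space with a dense embedding of `Y` into it. -/
structure Extension (Y : Type u) [TopologicalSpace Y] where
  space : Type u
  [top : TopologicalSpace space]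
  emb : Y → space
  isDenseEmbedding : IsDenseEmbedding emb

attribute [instance] Extension.top

namespace Extension

variable {Y : Type u} [TopologicalSpace Y]

/-- Equivalence (isomorphism) of extensions. -/
def Equivalent (E₁ E₂ : Extension Y) : Prop :=
  ∃ φ : E₁.space ≃ₜ E₂.space, φ ∘ E₁.emb = E₂.emb

/-- The projective preorder. -/
def ProjLE (E₁ E₂ : Extension Y) : Prop :=
  ∃ f : E₂.space → E₁.space, Continuous f ∧ f ∘ E₂.emb = E₁.emb

/-- The injective preorder. -/
def InjLE (E₁ E₂ : Extension Y) : Prop :=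
  ∃ f : E₁.space → E₂.space, Topology.IsEmbedding f ∧ f ∘ E₁.emb = E₂.emb

theorem Equivalent.refl (E : Extension Y) : Equivalent E E := ⟨Homeomorph.refl _, rfl⟩

theorem Equivalent.symm {E₁ E₂ : Extension Y} : Equivalent E₁ E₂ → Equivalent E₂ E₁ := by
  rintro ⟨φ, h⟩
  refine ⟨φ.symm, ?_⟩
  rw [← h]; ext y; simp

theorem Equivalent.trans {E₁ E₂ E₃ : Extension Y} :
    Equivalent E₁ E₂ → Equivalent E₂ E₃ → Equivalent E₁ E₃ := by
  rintro ⟨φ, h⟩ ⟨ψ, k⟩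
  refine ⟨φ.trans ψ, ?_⟩
  rw [← k, ← h]; rfl

theorem Equivalent.projLE {E₁ E₂ : Extension Y} : Equivalent E₁ E₂ → ProjLE E₂ E₁ := by
  rintro ⟨φ, h⟩
  exact ⟨φ, φ.continuous, h⟩

theorem Equivalent.injLE {E₁ E₂ : Extension Y} : Equivalent E₁ E₂ → InjLE E₁ E₂ := by
  rintro ⟨φ, h⟩
  exact ⟨φ, φ.isEmbedding, h⟩

theorem ProjLE.trans {E₁ E₂ E₃ : Extension Y} :
    ProjLE E₁ E₂ → ProjLE E₂ E₃ → ProjLE E₁ E₃ := by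
  rintro ⟨f, hf, h⟩ ⟨g, hg, k⟩
  refine ⟨f ∘ g, hf.comp hg, ?_⟩
  rw [← h, ← k]; rfl

theorem InjLE.trans {E₁ E₂ E₃ : Extension Y} :
    InjLE E₁ E₂ → InjLE E₂ E₃ → InjLE E₁ E₃ := by
  rintro ⟨f, hf, h⟩ ⟨g, hg, k⟩
  refine ⟨g ∘ f, hg.comp hf, ?_⟩
  rw [← k, ← h]; rfl

/-- Equivalence on the class of the extensions of `Y` that have the property `P`. -/
instance setoid (P : Extension Y → Prop) : Setoid (Subtype P) where
  r E₁ E₂ := Equivalent E₁.1 E₂.1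
  iseqv := ⟨fun E => Equivalent.refl E.1, Equivalent.symm, Equivalent.trans⟩

/-- The equivalence classes of the extensions of `Y` that have the property `P`. -/
abbrev Classes (P : Extension Y → Prop) : Type (u + 1) := Quotient (setoid P)

/-- The projective order on equivalence classes: `[E₁] ≤ [E₂]` iff `E₁ ≤ E₂`. -/
def projLE {P : Extension Y → Prop} : Classes P → Classes P → Prop :=
  Quotient.lift₂ (fun E₁ E₂ => ProjLE E₁.1 E₂.1) (fun _ _ _ _ h k => propext
    ⟨fun l => ((Equivalent.projLE h).trans l).trans (Equivalent.symm k).projLE,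
     fun l => ((Equivalent.symm h).projLE.trans l).trans (Equivalent.projLE k)⟩)

/-- The injective order on equivalence classes: `[E₁] ≤_in [E₂]` iff `E₁ ≤_in E₂`. -/
def injLE {P : Extension Y → Prop} : Classes P → Classes P → Prop :=
  Quotient.lift₂ (fun E₁ E₂ => InjLE E₁.1 E₂.1) (fun _ _ _ _ h k => propext
    ⟨fun l => ((Equivalent.symm h).injLE.trans l).trans (Equivalent.injLE k),
     fun l => ((Equivalent.injLE h).trans l).trans (Equivalent.symm k).injLE⟩)

end Extension

/-- The C-semiregular extensions of `Y`, up to equivalence. -/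
abbrev CSR (Y : Type u) [TopologicalSpace Y] : Type (u + 1) :=
  Extension.Classes (fun E : Extension Y => IsCSemiregular E.space)

/-- The connected C-semiregular extensions of `Y`, up to equivalence. As usual in general topology,
the empty space counts as connected. -/
abbrev CCSR (Y : Type u) [TopologicalSpace Y] : Type (u + 1) :=
  Extension.Classes (fun E : Extension Y => IsCSemiregular E.space ∧ PreconnectedSpace E.space)

end ContactExt

open ContactExt

/-!
For an extremally disconnected compact Hausdorff space `Y` every regular closed set is clopen, so
`Y` is the Stone space of `B = RC Y`: the points of `Y` are the ultrafilters of `B`.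

A contact relation `C` on `B` is turned into the space `ClanSpace C` of its clans, with the sets
`{Γ | a ∈ Γ}`, `a : B`, as a closed base; ultrafilters are clans, which gives a dense embedding
`clanPoint` of `Y` into it. Conversely a dense embedding `f : Y → X` induces an isomorphism
`RC.extend f : RC Y ≃o RC X`, `F ↦ cl (f F)`, along which the standard contact relation of `X` is
pulled back to a contact relation `inducedRel` on `B`.

The two constructions are mutually inverse. In `ClanSpace C` the closure of the copy of `a` is
`{Γ | a ∈ Γ}`, so two such closures meet iff a clan contains both `a` and `b`, which happens iff
`C a b`: by compactness of `Y` there are points `x ∈ a` and `y ∈ b` all of whose clopen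
neighbourhoods are pairwise in contact (`IsContact.exists_points`), and the union of the
corresponding ultrafilters is a clan. In the other direction, a C-semiregular extension of `Y` is
homeomorphic over `Y` to the clan space of its induced relation
(`Extension.equivalent_clanExtension`), a point going to the clan of the elements of `B` whose
extensions contain it.

As for the orders, a continuous map over `Y` maps `cl (f₁ F)` into `cl (f₂ F)`, hence makes the
induced relation larger, while an inclusion `C₁ ⊆ C₂` makes the clans of `C₁` clans of `C₂`, and
this inclusion of clan spaces is an embedding over `Y`. So both the projective and the injective
order translate into inclusion. Finally, connectedness of the induced relation is connectedness of
the space, since a clopen subset of `X` is `cl (f a)` for a unique `a`, whose complement is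
`cl (f aᶜ)`.
-/

namespace ContactExt

open Set Topology

/-! ### Contact relations and clans on Boolean algebras -/

section Algebra

variable {A B : Type u} [BooleanAlgebra A] [BooleanAlgebra B]

theorem IsPrecontact.mono {C : B → B → Prop} (hC : IsPrecontact C) {a a' b b' : B}
    (ha : a ≤ a') (hb : b ≤ b') (h : C a b) : C a' b' := by
  rw [← sup_eq_right.2 ha, hC.sup_left, ← sup_eq_right.2 hb, hC.sup_right]
  exact Or.inl (Or.inl h)

theorem IsContact.of_inf_ne_bot {C : B → B → Prop} (hC : IsContact C) {a b : B}
    (h : a ⊓ b ≠ ⊥) : C a b :=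
  hC.mono inf_le_left inf_le_right (hC.refl _ h)

theorem IsContact.sharp_iff {C : B → B → Prop} (hC : IsContact C) {a b : B} :
    sharp C a b ↔ C a b :=
  ⟨fun h => h.elim id fun h => h.elim (hC.symm _ _) hC.of_inf_ne_bot, Or.inl⟩

/-- The pullback of a contact relation along an isomorphism is a contact relation. -/
theorem IsContact.comap {D : B → B → Prop} (hD : IsContact D) (e : A ≃o B) :
    IsContact fun a b => D (e a) (e b) where
  ne_bot a b h := by simpa using hD.ne_bot _ _ h
  sup_right a b c := by simpa using hD.sup_right _ _ _
  sup_left a b c := by simpa using hD.sup_left _ _ _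
  refl a ha := hD.refl _ (by simpa using ha)
  symm a b h := hD.symm _ _ h

theorem IsClan.comap {D : B → B → Prop} {Γ : Set B} (h : IsClan D Γ) (e : A ≃o B) :
    IsClan (fun a b => D (e a) (e b)) (e ⁻¹' Γ) where
  nonempty := h.nonempty.preimage e.surjective
  bot_notMem := by simpa using h.bot_notMem
  mem_of_le a b ha hab := h.mem_of_le _ _ ha (e.monotone hab)
  mem_or_mem a b hab := h.mem_or_mem _ _ (by simpa using hab)
  sharp_of_mem a b ha hb := by
    refine (h.sharp_of_mem _ _ ha hb).imp id (Or.imp id fun h => ?_)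
    rwa [← map_inf, Ne, map_eq_bot_iff] at h

theorem IsClan.mono {C D : B → B → Prop} (hCD : ∀ a b, C a b → D a b) {Γ : Set B}
    (h : IsClan C Γ) : IsClan D Γ :=
  { h with
    sharp_of_mem := fun a b ha hb =>
      (h.sharp_of_mem a b ha hb).imp (hCD _ _) (Or.imp_left (hCD _ _)) }

theorem IsClan.top_mem {C : B → B → Prop} {Γ : Set B} (h : IsClan C Γ) : ⊤ ∈ Γ :=
  let ⟨a, ha⟩ := h.nonempty
  h.mem_of_le a ⊤ ha le_top

end Algebra

/-! ### Regular closed sets and dense embeddings -/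

namespace RC

variable {X Y : Type u} [TopologicalSpace X] [TopologicalSpace Y]

theorem notMem_bot (x : X) : x ∉ (⊥ : RC X).1 := id

theorem mem_top (x : X) : x ∈ (⊤ : RC X).1 := trivial

theorem nonempty_of_ne_bot {F : RC X} (h : F ≠ ⊥) : F.1.Nonempty :=
  nonempty_iff_ne_empty.2 fun h' => h (Subtype.ext h')

theorem isContact_contact (X : Type u) [TopologicalSpace X] : IsContact (contact X) where
  ne_bot F G := by
    rintro ⟨x, hF, hG⟩
    exact ⟨by rintro rfl; exact hF, by rintro rfl; exact hG⟩
  sup_right F G H := by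
    change (F.1 ∩ (G.1 ∪ H.1)).Nonempty ↔ _
    rw [inter_union_distrib_left, union_nonempty]; rfl
  sup_left F G H := by
    change ((F.1 ∪ G.1) ∩ H.1).Nonempty ↔ _
    rw [union_inter_distrib_right, union_nonempty]; rfl
  refl F hF := by
    obtain ⟨x, hx⟩ := nonempty_of_ne_bot hF
    exact ⟨x, hx, hx⟩
  symm F G h := by rwa [contact, inter_comm] at h

theorem isClan_sigma (x : X) : IsClan (contact X) (sigma x) where
  nonempty := ⟨⊤, mem_top x⟩
  bot_notMem := notMem_bot x
  mem_of_le _ _ ha hab := hab ha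
  mem_or_mem _ _ h := h
  sharp_of_mem _ _ ha hb := Or.inl ⟨x, ha, hb⟩

/-- A clopen set, as a regular closed set. -/
def ofClopen (S : Set X) (hS : IsClopen S) : RC X :=
  ⟨S, by rw [hS.isOpen.interior_eq, hS.isClosed.closure_eq]⟩

theorem _root_.IsDenseEmbedding.closure_image_preimage {f : Y → X} (hf : IsDenseEmbedding f)
    {U : Set X} (hU : IsOpen U) : closure (f '' (f ⁻¹' U)) = closure U := by
  rw [image_preimage_eq_inter_range]
  exact subset_antisymm (closure_mono inter_subset_left)
    (closure_minimal (hf.dense.open_subset_closure_inter hU) isClosed_closure)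

theorem closure_image_preimage_interior {f : Y → X} (hf : IsDenseEmbedding f) (G : RC X) :
    closure (f '' (f ⁻¹' interior G.1)) = G.1 := by
  rw [hf.closure_image_preimage isOpen_interior, G.2]

theorem preimage_closure_image {f : Y → X} (hf : IsDenseEmbedding f) (F : RC Y) :
    f ⁻¹' closure (f '' F.1) = F.1 := by
  rw [← hf.isInducing.closure_eq_preimage_closure_image, F.isClosed.closure_eq]

theorem regular_closure_image {f : Y → X} (hf : IsDenseEmbedding f) (F : RC Y) :
    closure (interior (closure (f '' F.1))) = closure (f '' F.1) := by
  obtain ⟨U, hU, hUF⟩ := hf.isInducing.isOpen_iff.1 (isOpen_interior (s := F.1))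
  have h : closure (f '' F.1) = closure U := by
    rw [← hf.closure_image_preimage hU, hUF]
    conv_lhs => rw [← F.2]
    exact closure_image_closure hf.continuous
  rw [h]
  exact regular_of_open hU

theorem regular_preimage {f : Y → X} (hf : IsDenseEmbedding f) (G : RC X) :
    closure (interior (f ⁻¹' G.1)) = f ⁻¹' G.1 := by
  have h : f ⁻¹' G.1 = closure (f ⁻¹' interior G.1) := by
    rw [hf.isInducing.closure_eq_preimage_closure_image, closure_image_preimage_interior hf]
  rw [h]
  exact regular_of_open (isOpen_interior.preimage hf.continuous)

theorem closure_image_preimage {f : Y → X} (hf : IsDenseEmbedding f) (G : RC X) :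
    closure (f '' (f ⁻¹' G.1)) = G.1 := by
  apply subset_antisymm
  · exact closure_minimal (image_preimage_subset _ _) G.isClosed
  · conv_lhs => rw [← closure_image_preimage_interior hf G]
    exact closure_mono (image_mono (preimage_mono interior_subset))

/-- The isomorphism `F ↦ cl (f F)` between the algebras of regular closed sets induced by a dense
embedding `f`; its inverse is `G ↦ f⁻¹ G`. -/
def extend (f : Y → X) (hf : IsDenseEmbedding f) : RC Y ≃o RC X where
  toFun F := ⟨closure (f '' F.1), regular_closure_image hf F⟩
  invFun G := ⟨f ⁻¹' G.1, regular_preimage hf G⟩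
  left_inv F := Subtype.ext (preimage_closure_image hf F)
  right_inv G := Subtype.ext (closure_image_preimage hf G)
  map_rel_iff' {F G} := by
    refine ⟨fun h => ?_, fun h => closure_mono (image_mono h)⟩
    have h' := preimage_mono (f := f) (show closure (f '' F.1) ⊆ closure (f '' G.1) from h)
    rwa [preimage_closure_image hf, preimage_closure_image hf] at h'

theorem emb_mem_extend {f : Y → X} (hf : IsDenseEmbedding f) {F : RC Y} {y : Y} :
    f y ∈ (extend f hf F).1 ↔ y ∈ F.1 := by
  conv_rhs => rw [← preimage_closure_image hf F]
  rfl

theorem map_mem_extend {X' : Type u} [TopologicalSpace X'] {f : Y → X} (hf : IsDenseEmbedding f)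
    {f' : Y → X'} (hf' : IsDenseEmbedding f') {g : X → X'} (hg : Continuous g) (h : g ∘ f = f')
    {F : RC Y} {x : X} (hx : x ∈ (extend f hf F).1) : g x ∈ (extend f' hf' F).1 := by
  have := image_closure_subset_closure_image hg (mem_image_of_mem g hx)
  rwa [← image_comp, h] at this

/-! ### Regular closed sets of extremally disconnected spaces -/

theorem isClopen [ExtremallyDisconnected Y] (F : RC Y) : IsClopen F.1 :=
  ⟨F.isClosed, by rw [← F.2]; exact ExtremallyDisconnected.open_closure _ isOpen_interior⟩

theorem mem_inf [ExtremallyDisconnected Y] {F G : RC Y} {y : Y} :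
    y ∈ (F ⊓ G).1 ↔ y ∈ F.1 ∧ y ∈ G.1 := by
  change y ∈ closure (interior (F.1 ∩ G.1)) ↔ _
  have h := F.isClopen.inter G.isClopen
  rw [h.isOpen.interior_eq, h.isClosed.closure_eq]; rfl

theorem exists_mem_subset [CompactSpace Y] [T2Space Y] [ExtremallyDisconnected Y] {U : Set Y}
    (hU : IsOpen U) {y : Y} (hy : y ∈ U) : ∃ F : RC Y, y ∈ F.1 ∧ F.1 ⊆ U := by
  obtain ⟨S, hS, hyS, hSU⟩ := compact_exists_isClopen_in_isOpen hU hy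
  exact ⟨ofClopen S hS, hyS, hSU⟩

/-- An ideal of clopen sets that covers `K` contains `K`. -/
theorem ideal_of_forall_point [CompactSpace Y] [ExtremallyDisconnected Y] {p : RC Y → Prop}
    (bot : p ⊥) (mono : ∀ F G, F ≤ G → p G → p F) (sup : ∀ F G, p F → p G → p (F ⊔ G))
    {K : RC Y} (h : ∀ x ∈ K.1, ∃ F, x ∈ F.1 ∧ p F) : p K := by
  have : ∃ F : RC Y, K.1 ⊆ F.1 ∧ p F := by
    refine K.isClosed.isCompact.induction_on (p := fun S => ∃ F : RC Y, S ⊆ F.1 ∧ p F)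
      ⟨⊥, empty_subset _, bot⟩ ?_ ?_ ?_
    · rintro S T hST ⟨F, hTF, hF⟩
      exact ⟨F, hST.trans hTF, hF⟩
    · rintro S T ⟨F, hSF, hF⟩ ⟨G, hTG, hG⟩
      exact ⟨F ⊔ G, union_subset_union hSF hTG, sup _ _ hF hG⟩
    · intro x hx
      obtain ⟨F, hxF, hF⟩ := h x hx
      exact ⟨F.1, mem_nhdsWithin_of_mem_nhds (F.isClopen.isOpen.mem_nhds hxF), F, subset_rfl, hF⟩
  obtain ⟨F, hKF, hF⟩ := this
  exact mono _ _ hKF hF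

end RC

section Stone

variable {Y : Type u} [TopologicalSpace Y] [ExtremallyDisconnected Y]

/-- If all clopen neighbourhoods of two points are in contact, the union of the ultrafilters of
these points is a clan. -/
theorem IsContact.isClan_union {C : RC Y → RC Y → Prop} (hC : IsContact C) {x y : Y}
    (h : ∀ F G : RC Y, x ∈ F.1 → y ∈ G.1 → C F G) : IsClan C (RC.sigma x ∪ RC.sigma y) where
  nonempty := ⟨⊤, Or.inl (RC.mem_top x)⟩
  bot_notMem h := h.elim id id
  mem_of_le a b ha hab := ha.imp (fun h => hab h) (fun h => hab h)
  mem_or_mem a b hab := hab.elim (fun h => h.imp Or.inl Or.inl) (fun h => h.imp Or.inr Or.inr)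
  sharp_of_mem a b ha hb := by
    have key : ∀ z : Y, z ∈ a.1 → z ∈ b.1 → C a b := fun z hza hzb =>
      hC.of_inf_ne_bot fun h => by
        have hz := RC.mem_inf.2 ⟨hza, hzb⟩
        rw [h] at hz
        exact hz
    left
    rcases ha with ha | ha <;> rcases hb with hb | hb
    · exact key x ha hb
    · exact h _ _ ha hb
    · exact hC.symm _ _ (h _ _ hb ha)
    · exact key y ha hb

theorem IsContact.isClan_sigma {C : RC Y → RC Y → Prop} (hC : IsContact C) (y : Y) :
    IsClan C (RC.sigma y) := by
  rw [← union_self (RC.sigma y)]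
  refine hC.isClan_union fun F G hF hG => hC.of_inf_ne_bot fun h => ?_
  have hz := RC.mem_inf.2 ⟨hF, hG⟩
  rw [h] at hz
  exact hz

/-- Two sets in contact contain two points such that any clopen neighbourhoods of these points are
in contact. -/
theorem IsContact.exists_points [CompactSpace Y] {C : RC Y → RC Y → Prop} (hC : IsContact C) {a b : RC Y}
    (h : C a b) : ∃ x ∈ a.1, ∃ y ∈ b.1, ∀ F G : RC Y, x ∈ F.1 → y ∈ G.1 → C F G := by
  by_contra! H
  refine RC.ideal_of_forall_point (p := fun F => ¬ C F b) (fun h => (hC.ne_bot _ _ h).1 rfl)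
    (fun F G hFG hG hF => hG (hC.mono hFG le_rfl hF))
    (fun F G hF hG h => ((hC.sup_left _ _ _).1 h).elim hF hG) (fun x hx => ?_) h
  -- The clopen sets that are not in contact with some neighbourhood of `x` form an ideal too.
  refine RC.ideal_of_forall_point (p := fun G => ∃ F : RC Y, x ∈ F.1 ∧ ¬ C F G)
    ⟨⊤, RC.mem_top x, fun h => (hC.ne_bot _ _ h).2 rfl⟩ ?_ ?_ (fun y hy => ?_)
  · rintro G G' hG ⟨F, hxF, hF⟩
    exact ⟨F, hxF, fun h => hF (hC.mono le_rfl hG h)⟩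
  · rintro G G' ⟨F, hxF, hF⟩ ⟨F', hxF', hF'⟩
    refine ⟨F ⊓ F', RC.mem_inf.2 ⟨hxF, hxF'⟩, fun h => ?_⟩
    exact ((hC.sup_right _ _ _).1 h).elim (fun h => hF (hC.mono inf_le_left le_rfl h))
      (fun h => hF' (hC.mono inf_le_right le_rfl h))
  · obtain ⟨F, G, hxF, hyG, hFG⟩ := H x hx y hy
    exact ⟨G, hyG, F, hxF, hFG⟩

end Stone

/-! ### The space of clans -/

/-- The set of clans of `(B, C)`, the carrier of the canonical extension. -/
def ClanSpace {B : Type u} [BooleanAlgebra B] (C : B → B → Prop) : Type u :=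
  {Γ : Set B // IsClan C Γ}

namespace ClanSpace

section Algebra

variable {B : Type u} [BooleanAlgebra B] {C : B → B → Prop}

/-- The topology with the sets `{Γ | a ∈ Γ}` as a closed base: their complements are closed under
finite intersections, so `U` is open iff each of its points has such a complement inside `U`. -/
instance : TopologicalSpace (ClanSpace C) where
  IsOpen U := ∀ Γ ∈ U, ∃ a, a ∉ Γ.1 ∧ ∀ Δ : ClanSpace C, a ∉ Δ.1 → Δ ∈ U
  isOpen_univ Γ _ := ⟨⊥, Γ.2.bot_notMem, fun _ _ => trivial⟩
  isOpen_inter U V hU hV Γ hΓ := by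
    obtain ⟨a, ha, haU⟩ := hU Γ hΓ.1
    obtain ⟨b, hb, hbV⟩ := hV Γ hΓ.2
    exact ⟨a ⊔ b, fun h => (Γ.2.mem_or_mem _ _ h).elim ha hb, fun Δ hΔ =>
      ⟨haU Δ fun h => hΔ (Δ.2.mem_of_le _ _ h le_sup_left),
        hbV Δ fun h => hΔ (Δ.2.mem_of_le _ _ h le_sup_right)⟩⟩
  isOpen_sUnion S hS Γ := by
    rintro ⟨U, hU, hΓ⟩
    obtain ⟨a, ha, haU⟩ := hS U hU Γ hΓ
    exact ⟨a, ha, fun Δ hΔ => ⟨U, hU, haU Δ hΔ⟩⟩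

theorem isOpen_iff {U : Set (ClanSpace C)} :
    IsOpen U ↔ ∀ Γ ∈ U, ∃ a, a ∉ Γ.1 ∧ ∀ Δ : ClanSpace C, a ∉ Δ.1 → Δ ∈ U := Iff.rfl

theorem isClosed_setOf_mem (a : B) : IsClosed {Γ : ClanSpace C | a ∈ Γ.1} := by
  rw [← isOpen_compl_iff, isOpen_iff]
  exact fun Γ hΓ => ⟨a, hΓ, fun _ h => h⟩

theorem exists_of_isClosed {K : Set (ClanSpace C)} (hK : IsClosed K) {Γ : ClanSpace C}
    (hΓ : Γ ∉ K) : ∃ a, a ∉ Γ.1 ∧ ∀ Δ ∈ K, a ∈ Δ.1 := by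
  obtain ⟨a, ha, h⟩ := isOpen_iff.1 hK.isOpen_compl Γ hΓ
  exact ⟨a, ha, fun Δ hΔ => by_contra fun h' => h Δ h' hΔ⟩

/-- The topology of a clan space is induced by any map to it under which the closed base pulls back
to a closed base. -/
theorem isInducing_of {X : Type u} [TopologicalSpace X] {f : X → ClanSpace C}
    (hf : ∀ a, IsClosed {x | a ∈ (f x).1})
    (h : ∀ U, IsOpen U → ∀ x ∈ U, ∃ a, a ∉ (f x).1 ∧ ∀ z, a ∉ (f z).1 → z ∈ U) :
    IsInducing f := by
  have cont : Continuous f := by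
    refine continuous_def.2 fun U hU => isOpen_iff_forall_mem_open.2 fun x hx => ?_
    obtain ⟨a, ha, haU⟩ := isOpen_iff.1 hU _ hx
    exact ⟨_, fun z hz => haU _ hz, (hf a).isOpen_compl, ha⟩
  refine isInducing_iff_nhds.2 fun x => le_antisymm cont.continuousAt.le_comap fun U hU => ?_
  obtain ⟨V, hVU, hV, hxV⟩ := mem_nhds_iff.1 hU
  obtain ⟨a, ha, haV⟩ := h V hV x hxV
  exact ⟨_, (isClosed_setOf_mem a).isOpen_compl.mem_nhds ha, fun z hz => hVU (haV z hz)⟩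

/-- The inclusion of clan spaces that comes from an inclusion of relations. -/
def map {D : B → B → Prop} (h : ∀ a b, C a b → D a b) (Γ : ClanSpace C) : ClanSpace D :=
  ⟨Γ.1, Γ.2.mono h⟩

theorem isEmbedding_map {D : B → B → Prop} (h : ∀ a b, C a b → D a b) : IsEmbedding (map h) :=
  ⟨isInducing_of isClosed_setOf_mem fun _ hU => isOpen_iff.1 hU,
    fun _ _ hΓ => Subtype.ext (congrArg Subtype.val hΓ :)⟩

instance : T0Space (ClanSpace C) where
  t0 _ _ h := Subtype.ext <| Set.ext fun a => h.mem_closed_iff (isClosed_setOf_mem a)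

end Algebra

/-! ### The clan space as an extension -/

section Stone

variable {Y : Type u} [TopologicalSpace Y] [ExtremallyDisconnected Y] {C : RC Y → RC Y → Prop}

/-- The map from `Y` to the clan space that sends a point to its ultrafilter. -/
def clanPoint (hC : IsContact C) (y : Y) : ClanSpace C := ⟨RC.sigma y, hC.isClan_sigma y⟩

theorem closure_image_clanPoint (hC : IsContact C) (a : RC Y) :
    closure (clanPoint hC '' a.1) = {Γ | a ∈ Γ.1} := by
  refine subset_antisymm (closure_minimal (image_subset_iff.2 fun _ h => h)
    (isClosed_setOf_mem a)) fun Γ hΓ => by_contra fun h => ?_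
  obtain ⟨b, hb, hab⟩ := exists_of_isClosed isClosed_closure h
  exact hb (Γ.2.mem_of_le a b hΓ fun y hy => hab _ (subset_closure (mem_image_of_mem _ hy)))

theorem isDenseEmbedding_clanPoint [CompactSpace Y] [T2Space Y] (hC : IsContact C) :
    IsDenseEmbedding (clanPoint hC) where
  toIsInducing := by
    refine isInducing_of (fun a => a.isClosed) fun U hU x hx => ?_
    obtain ⟨F, hxF, hFU⟩ := RC.exists_mem_subset hU hx
    exact ⟨RC.ofClopen F.1ᶜ F.isClopen.compl, fun h => h hxF,
      fun z hz => hFU (not_not.1 hz)⟩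
  dense Γ := by
    have h := closure_image_clanPoint hC ⊤
    rw [show (⊤ : RC Y).1 = univ from rfl, image_univ] at h
    rw [h]
    exact Γ.2.top_mem
  injective x y h := by
    by_contra hxy
    obtain ⟨F, hxF, hF⟩ := RC.exists_mem_subset (isOpen_compl_singleton (x := y)) hxy
    have hs : RC.sigma x = RC.sigma y := congrArg Subtype.val h
    have hyF : F ∈ RC.sigma y := by rw [← hs]; exact hxF
    exact hF hyF rfl

end Stone

end ClanSpace

/-! ### The contact relation induced by an extension -/

section Extension

variable {Y : Type u} [TopologicalSpace Y]

/-- The contact relation on `RC Y` induced by an extension of `Y`: two sets are in contact iff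
their closures in the extension meet. -/
def Extension.inducedRel (E : Extension Y) (F G : RC Y) : Prop :=
  RC.contact E.space (RC.extend E.emb E.isDenseEmbedding F)
    (RC.extend E.emb E.isDenseEmbedding G)

theorem Extension.isContact_inducedRel (E : Extension Y) : IsContact E.inducedRel :=
  (RC.isContact_contact E.space).comap _

theorem Extension.inducedRel_mono {E₁ E₂ : Extension Y} {g : E₁.space → E₂.space}
    (hg : Continuous g) (h : g ∘ E₁.emb = E₂.emb) {F G : RC Y} :
    E₁.inducedRel F G → E₂.inducedRel F G := by
  rintro ⟨x, hF, hG⟩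
  exact ⟨g x, RC.map_mem_extend E₁.isDenseEmbedding E₂.isDenseEmbedding hg h hF,
    RC.map_mem_extend E₁.isDenseEmbedding E₂.isDenseEmbedding hg h hG⟩

/-! ### Connectedness -/

theorem Extension.isConnectedRel_inducedRel (E : Extension Y) :
    IsConnectedRel E.inducedRel ↔ PreconnectedSpace E.space := by
  let e := RC.extend E.emb E.isDenseEmbedding
  constructor
  · refine fun h => preconnectedSpace_iff_clopen.2 fun S hS => ?_
    obtain ⟨a, ha⟩ := e.surjective (RC.ofClopen S hS)
    by_cases h0 : a = ⊥
    · left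
      rw [h0, map_bot] at ha
      exact congrArg Subtype.val ha.symm
    by_cases h1 : a = ⊤
    · right
      rw [h1, map_top] at ha
      exact congrArg Subtype.val ha.symm
    exfalso
    have hc : (e aᶜ).1 = Sᶜ := by
      rw [map_compl, ha]
      exact hS.compl.isClosed.closure_eq
    have hS' : (e a).1 = S := congrArg Subtype.val ha
    rcases h a h0 h1 with ⟨x, hx, hx'⟩ | ⟨x, hx', hx⟩
    all_goals
      change x ∈ (e a).1 at hx
      change x ∈ (e aᶜ).1 at hx'
      rw [hS'] at hx
      rw [hc] at hx'
      exact hx' hx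
  · intro h a h0 h1
    left
    have hcover : (univ : Set E.space) ⊆ (e a).1 ∪ (e aᶜ).1 := by
      have h : e a ⊔ e aᶜ = ⊤ := by rw [← map_sup, sup_compl_eq_top, map_top]
      exact (congrArg Subtype.val h).ge
    have ne : ∀ b : RC Y, b ≠ ⊥ → (univ ∩ (e b).1).Nonempty := fun b hb => by
      rw [univ_inter]
      exact RC.nonempty_of_ne_bot (by simpa using hb)
    have := isPreconnected_closed_iff.1 h.isPreconnected_univ _ _ (e a).isClosed (e aᶜ).isClosed
      hcover (ne a h0) (ne _ (by simpa using h1))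
    rwa [univ_inter] at this

/-! ### The correspondence between relations and extensions -/

open ClanSpace

variable [CompactSpace Y] [T2Space Y] [ExtremallyDisconnected Y]

/-- The canonical extension of `Y` defined by a contact relation on `RC Y`. -/
def clanExtension {C : RC Y → RC Y → Prop} (hC : IsContact C) : Extension Y where
  space := ClanSpace C
  emb := clanPoint hC
  isDenseEmbedding := isDenseEmbedding_clanPoint hC

theorem mem_extend_clanExtension {C : RC Y → RC Y → Prop} (hC : IsContact C) {a : RC Y}
    {Γ : ClanSpace C} :
    Γ ∈ (RC.extend _ (isDenseEmbedding_clanPoint hC) a).1 ↔ a ∈ Γ.1 :=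
  iff_of_eq (congrArg (Γ ∈ ·) (closure_image_clanPoint hC a))

theorem inducedRel_clanExtension {C : RC Y → RC Y → Prop} (hC : IsContact C) :
    (clanExtension hC).inducedRel = C := by
  ext a b
  constructor
  · rintro ⟨Γ, ha, hb⟩
    exact hC.sharp_iff.1 (Γ.2.sharp_of_mem a b ((mem_extend_clanExtension hC).1 ha)
      ((mem_extend_clanExtension hC).1 hb))
  · intro h
    obtain ⟨x, hx, y, hy, hxy⟩ := hC.exists_points h
    exact ⟨⟨_, hC.isClan_union hxy⟩, (mem_extend_clanExtension hC).2 (Or.inl hx),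
      (mem_extend_clanExtension hC).2 (Or.inr hy)⟩

theorem isCSemiregular_clanExtension {C : RC Y → RC Y → Prop} (hC : IsContact C) :
    IsCSemiregular (clanExtension hC).space where
  t0 := inferInstanceAs (T0Space (ClanSpace C))
  semiregular K hK := by
    refine ⟨{F | K ⊆ F.1}, subset_antisymm (subset_iInter₂ fun F hF => hF) fun Γ hΓ => ?_⟩
    by_contra h
    obtain ⟨a, ha, haK⟩ := exists_of_isClosed (C := C) hK h
    exact ha ((mem_extend_clanExtension hC).1 (mem_iInter₂.1 hΓ
      (RC.extend _ (isDenseEmbedding_clanPoint hC) a)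
      fun Δ hΔ => (mem_extend_clanExtension hC).2 (haK Δ hΔ)))
  exists_point Γ hΓ := by
    let e := RC.extend _ (isDenseEmbedding_clanPoint hC)
    have h : IsClan (clanExtension hC).inducedRel (e ⁻¹' Γ) := hΓ.comap e
    rw [inducedRel_clanExtension] at h
    refine ⟨(⟨_, h⟩ : ClanSpace C), Set.ext fun F => ?_⟩
    obtain ⟨a, rfl⟩ := e.surjective F
    exact (mem_extend_clanExtension hC (Γ := ⟨_, h⟩)).symm

/-- A C-semiregular extension is determined by its induced contact relation: it is the clan space
of this relation. -/
theorem Extension.equivalent_clanExtension (E : Extension Y) (hE : IsCSemiregular E.space) :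
    Equivalent (clanExtension E.isContact_inducedRel) E := by
  let e := RC.extend E.emb E.isDenseEmbedding
  let g : E.space → ClanSpace E.inducedRel := fun x =>
    ⟨e ⁻¹' RC.sigma x, (RC.isClan_sigma x).comap e⟩
  have ind : IsInducing g := by
    refine isInducing_of (fun a => (e a).isClosed) fun U hU x hx => ?_
    obtain ⟨R, hR⟩ := hE.semiregular Uᶜ hU.isClosed_compl
    have hxR : x ∉ ⋂ F ∈ R, F.1 := by rw [← hR]; exact fun h => h hx
    simp only [mem_iInter, not_forall] at hxR
    obtain ⟨F, hF, hxF⟩ := hxR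
    obtain ⟨a, rfl⟩ := e.surjective F
    refine ⟨a, hxF, fun z hz => by_contra fun hzU => hz ?_⟩
    have hzR : z ∈ ⋂ F ∈ R, F.1 := by rw [← hR]; exact hzU
    exact mem_iInter₂.1 hzR _ hF
  have surj : Function.Surjective g := by
    intro Γ
    have h := Γ.2.comap e.symm
    simp only [inducedRel] at h
    have h' : IsClan (RC.contact E.space) (e.symm ⁻¹' Γ.1) := by
      convert h using 3 with F G
      rw [← e.apply_symm_apply F, ← e.apply_symm_apply G]
      simp only [e, OrderIso.symm_apply_apply]
    obtain ⟨x, hx⟩ := hE.exists_point _ h'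
    refine ⟨x, Subtype.ext ?_⟩
    change e ⁻¹' RC.sigma x = Γ.1
    rw [← hx, ← preimage_comp]
    ext a
    simp
  have := hE.t0
  let φ : E.space ≃ₜ ClanSpace E.inducedRel :=
    (Equiv.ofBijective g ⟨ind.injective, surj⟩).toHomeomorphOfIsInducing ind
  refine Equivalent.symm ⟨φ, funext fun y => Subtype.ext <| Set.ext fun a => ?_⟩
  exact RC.emb_mem_extend E.isDenseEmbedding

/-! ### The order isomorphisms -/

theorem projLE_clanExtension {C₁ C₂ : RC Y → RC Y → Prop} (h₁ : IsContact C₁)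
    (h₂ : IsContact C₂) :
    Extension.ProjLE (clanExtension h₁) (clanExtension h₂) ↔ ∀ a b, C₂ a b → C₁ a b := by
  constructor
  · rintro ⟨g, hg, h⟩ a b
    have := Extension.inducedRel_mono hg h (F := a) (G := b)
    rwa [inducedRel_clanExtension, inducedRel_clanExtension] at this
  · exact fun h => ⟨map h, (isEmbedding_map h).continuous, rfl⟩

theorem injLE_clanExtension {C₁ C₂ : RC Y → RC Y → Prop} (h₁ : IsContact C₁)
    (h₂ : IsContact C₂) :
    Extension.InjLE (clanExtension h₁) (clanExtension h₂) ↔ ∀ a b, C₁ a b → C₂ a b := by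
  constructor
  · rintro ⟨g, hg, h⟩
    exact (projLE_clanExtension h₂ h₁).1 ⟨g, hg.continuous, h⟩
  · exact fun h => ⟨map h, isEmbedding_map h, rfl⟩

/-- A class of contact relations and a class of C-semiregular extensions that correspond to each
other under `Extension.inducedRel` are isomorphic, for both orders. -/
theorem nonempty_relIso {P : (RC Y → RC Y → Prop) → Prop} {Q : Extension Y → Prop}
    (hP : ∀ C, P C → IsContact C) (hQ : ∀ E, Q E ↔ IsCSemiregular E.space ∧ P E.inducedRel) :
    Nonempty ((relLE : Subtype P → Subtype P → Prop) ≃r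
      (Extension.projLE : Extension.Classes Q → Extension.Classes Q → Prop)) ∧
    Nonempty ((relSubset : Subtype P → Subtype P → Prop) ≃r
      (Extension.injLE : Extension.Classes Q → Extension.Classes Q → Prop)) := by
  let Φ : Subtype P → Extension.Classes Q := fun C => Quotient.mk _
    ⟨clanExtension (hP C.1 C.2), (hQ _).2 ⟨isCSemiregular_clanExtension _,
      by rw [inducedRel_clanExtension]; exact C.2⟩⟩
  have proj : ∀ C D, Extension.projLE (Φ C) (Φ D) ↔ relLE C D := fun C D =>
    projLE_clanExtension (hP C.1 C.2) (hP D.1 D.2)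
  have inj : ∀ C D, Extension.injLE (Φ C) (Φ D) ↔ relSubset C D := fun C D =>
    injLE_clanExtension (hP C.1 C.2) (hP D.1 D.2)
  have injective : Function.Injective Φ := fun C D h => by
    have hCD : relLE C D := (proj C D).1 (h ▸ (proj C C).2 fun _ _ => id)
    have hDC : relLE D C := (proj D C).1 (h ▸ (proj D D).2 fun _ _ => id)
    exact Subtype.ext (funext₂ fun a b => propext ⟨hDC a b, hCD a b⟩)
  have surjective : Function.Surjective Φ := by
    rintro ⟨E, hE⟩
    exact ⟨⟨E.inducedRel, ((hQ E).1 hE).2⟩,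
      Quotient.sound (E.equivalent_clanExtension ((hQ E).1 hE).1)⟩
  let e := Equiv.ofBijective Φ ⟨injective, surjective⟩
  exact ⟨⟨⟨e, proj _ _⟩⟩, ⟨⟨e, inj _ _⟩⟩⟩

end Extension

end ContactExt

theorem theorem9p1 (Y : Type u) [TopologicalSpace Y] [CompactSpace Y] [T2Space Y]
    [ExtremallyDisconnected Y] :
    Nonempty ((relLE : CRel (RC Y) → CRel (RC Y) → Prop) ≃r
      (Extension.projLE : CSR Y → CSR Y → Prop)) ∧
    Nonempty ((relSubset : CRel (RC Y) → CRel (RC Y) → Prop) ≃r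
      (Extension.injLE : CSR Y → CSR Y → Prop)) ∧
    Nonempty ((relLE : CCRel (RC Y) → CCRel (RC Y) → Prop) ≃r
      (Extension.projLE : CCSR Y → CCSR Y → Prop)) ∧
    Nonempty ((relSubset : CCRel (RC Y) → CCRel (RC Y) → Prop) ≃r
      (Extension.injLE : CCSR Y → CCSR Y → Prop)) := by
  have hc := nonempty_relIso (Y := Y) (P := IsContact)
    (Q := fun E => IsCSemiregular E.space) (fun _ h => h)
    fun E => ⟨fun h => ⟨h, E.isContact_inducedRel⟩, fun h => h.1⟩
  have hcc := nonempty_relIso (Y := Y) (P := fun C => IsContact C ∧ IsConnectedRel C)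
    (Q := fun E => IsCSemiregular E.space ∧ PreconnectedSpace E.space) (fun _ h => h.1)
    fun E => and_congr_right fun _ => E.isConnectedRel_inducedRel.symm.trans
      ⟨fun h => ⟨E.isContact_inducedRel, h⟩, fun h => h.2⟩
  exact ⟨hc.1, hc.2, hcc.1, hcc.2⟩
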